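/- Let $p\in(1,\infty)$. Put $F_p(y)=\int_0^y(1-t^p)^{-1/p}\,dt$ for $y\in[0,1]$ and $\pi_p=2F_p(1)$. Let $\sin_p$ be the inverse of $F_p:[0,1]\to[0,\pi_p/2]$, extended to a $2\pi_p$-periodic function on $\mathbb R$ by the rules $\sin_p(-x)=-\sin_p x$ and $\sin_p(\tfrac{\pi_p}{2}-x)=\sin_p(\tfrac{\pi_p}{2}+x)$. For real $q>1$ the function $x\mapsto|\sin_p x/x|^q$ is integrable on $(0,\infty)$; put $$I_p(q)=q^{1/p}\int_0^\infty\left|\frac{\sin_p x}{x}\right|^q dx .$$ Then there are real constants $\gamma_2,\gamma_3,\dots$ (depending on $p$ but not on $q$) such that, as $q\to\infty$ through the reals, $$I_p(q)\sim (p(p+1))^{1/p}\left(\frac1p\Gamma\!\left(\frac1p\right)+\frac1p\Gamma\!\left(\frac1p\right)\frac{(-p^2+p+1)(p+1)}{2p(2p+1)}\,\frac1q+\sum_{j=2}^\infty\Gamma\!\left(j+\frac1p\right)\frac{\gamma_j}{q^j}\right)$$ as an asymptotic expansion in the sense of Poincaré: writing the right-hand side as $\sum_{j\ge0}a_jq^{-j}$,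 for every integer $n\ge0$ we have $I_p(q)-\sum_{j<n}a_jq^{-j}=O(q^{-n})$ as $q\to\infty$. In particular, $$\lim_{q\to\infty}I_p(q)=\frac1p\,\Gamma\!\left(\frac1p\right)(p(p+1))^{1/p}.$$ -/

import Mathlib

open Set Filter Topology MeasureTheory Asymptotics

noncomputable section

/-- The function `F_p(y) = ∫₀^y (1 - t^p)^(-1/p) dt`, used for `0 ≤ y ≤ 1`. -/
def pArcsin (p y : ℝ) : ℝ :=
  ∫ t in (0 : ℝ)..y, (1 - t ^ p) ^ (-(1 / p))

/-- The generalised `π`, that is `π_p = 2 F_p(1)`. -/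
def pPi (p : ℝ) : ℝ :=
  2 * pArcsin p 1

/-- `sin_p` on `[0, π_p / 2]`: the inverse of `F_p : [0, 1] → [0, π_p / 2]`. -/
def pSinQuarter (p x : ℝ) : ℝ :=
  Function.invFunOn (pArcsin p) (Icc 0 1) x

/-- `sin_p` on `[-π_p / 2, π_p / 2]`: the odd extension, `sin_p (-x) = -sin_p x`. -/
def pSinHalf (p x : ℝ) : ℝ :=
  if 0 ≤ x then pSinQuarter p x else -pSinQuarter p (-x)

/-- The representative of `x` modulo `2 π_p` in `[-π_p / 2, 3 π_p / 2)`. -/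
def pReduce (p x : ℝ) : ℝ :=
  x - 2 * pPi p * (⌊(x + pPi p / 2) / (2 * pPi p)⌋ : ℤ)

/-- The generalised sine `sin_p` on the whole of `ℝ`: the `2 π_p`-periodic function which is
`pSinHalf p` on `[-π_p / 2, π_p / 2]` and is extended to `[π_p / 2, 3 π_p / 2]` by the reflection
`sin_p (π_p / 2 + x) = sin_p (π_p / 2 - x)`, i.e. `sin_p r = sin_p (π_p - r)`. -/
def pSin (p x : ℝ) : ℝ :=
  if pReduce p x ≤ pPi p / 2 then pSinHalf p (pReduce p x)
  else pSinHalf p (pPi p - pReduce p x)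

/-- The `p`-Ball integral `I_p(q) = q^(1/p) ∫₀^∞ |sin_p x / x|^q dx`. -/
def pBall (p q : ℝ) : ℝ :=
  q ^ (1 / p) * ∫ x in Ioi (0 : ℝ), |pSin p x / x| ^ q

/-- `f(q) ∼ ∑_{j ≥ 0} a_j q^(-j)` as `q → ∞` over the reals, in the sense of Poincaré: for each
`n`, the remainder after the first `n` terms is `O(q^(-n))`. No convergence is asserted. -/
def HasAsymptoticExpansion (f : ℝ → ℝ) (a : ℕ → ℝ) : Prop :=
  ∀ n : ℕ, (fun q : ℝ => f q - ∑ j ∈ Finset.range n, a j / q ^ j) =O[atTop]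
    (fun q : ℝ => 1 / q ^ n)

/-- The coefficients of the expansion of `I_p(q)` in powers of `1 / q`, without the common factor
`(p (p + 1))^(1/p)`; `γ` gives the coefficients that are not explicit (only `γ_2, γ_3, …` occur). -/
def pBallCoeff (p : ℝ) (γ : ℕ → ℝ) : ℕ → ℝ
  | 0 => 1 / p * Real.Gamma (1 / p)
  | 1 => 1 / p * Real.Gamma (1 / p) *
      ((-p ^ 2 + p + 1) * (p + 1) / (2 * p * (2 * p + 1)))
  | j + 2 => Real.Gamma (((j + 2 : ℕ) : ℝ) + 1 / p) * γ (j + 2)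

end

/-! ### The integral `pArcsin`, its inverse, and elementary bounds for `pSin`. -/

section Arcsin

variable {p : ℝ}

/-! This is Laplace's method, made exact by a change of variable. For small x > 0 put y = sin_p x
and s = log (x / y), so that the integrand becomes exp(-q s). Integrating the binomial series gives
x = F_p(y) = y G(y^p) with G analytic, G(0) = 1 and G'(0) ≠ 0. Hence s is determined by G(u) = exp s
with u = y^p, and inverting gives u = s m(s) with m analytic (`exists_analyticAt_comp_mul_eq_exp`).
Then x = y exp s = s^(1/p) k(s) with k = m^(1/p) exp analytic (`exists_analyticAt_pArcsin_param`).

Near the origin the Ball integral is therefore the integral of s^(1/p - 1) h(s) exp(-q s) with h =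
k/p + s k' (`setIntegral_pSin_eq`), and `watson` expands it: the j-th coefficient is Γ(j + 1/p)
times the j-th Taylor coefficient of h. The first two follow from the Taylor coefficients of G up to
order two.

The rest of the half-line is exponentially negligible: F_p(y)/y increases with y (`pArcsin_mul_le`),
so away from 0 the ratio |sin_p x / x| stays below a constant less than 1 (`abs_pSin_div_le_of_le`,
`isBigO_setIntegral_Ici_pSin`). -/

lemma rpow_weight_nonneg (hp : 1 < p) {t : ℝ} (ht0 : 0 ≤ t) (ht1 : t ≤ 1) :
    0 ≤ (1 - t ^ p) ^ (-(1 / p)) :=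
  Real.rpow_nonneg (sub_nonneg.2 (Real.rpow_le_one ht0 ht1 (by linarith))) _

lemma rpow_weight_mono (hp : 1 < p) {s t : ℝ} (hs0 : 0 ≤ s) (hst : s ≤ t) (ht1 : t < 1) :
    (1 - s ^ p) ^ (-(1 / p)) ≤ (1 - t ^ p) ^ (-(1 / p)) := by
  have h1 : t ^ p < 1 := Real.rpow_lt_one (hs0.trans hst) ht1 (by linarith)
  have h2 : s ^ p ≤ t ^ p := Real.rpow_le_rpow hs0 hst (by linarith)
  exact Real.rpow_le_rpow_of_nonpos (by linarith) (by linarith)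
    (neg_nonpos.2 (by positivity))

lemma one_le_rpow_weight (hp : 1 < p) {t : ℝ} (ht0 : 0 ≤ t) (ht1 : t < 1) :
    1 ≤ (1 - t ^ p) ^ (-(1 / p)) := by
  have := rpow_weight_mono hp le_rfl ht0 ht1
  rwa [Real.zero_rpow (by linarith), sub_zero, Real.one_rpow] at this

lemma intervalIntegrable_rpow_weight (hp : 1 < p) :
    IntervalIntegrable (fun t : ℝ => (1 - t ^ p) ^ (-(1 / p))) volume 0 1 := by
  have h : IntervalIntegrable (fun t : ℝ => (1 - t) ^ (-(1 / p))) volume 0 1 := by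
    have h0 : IntervalIntegrable (fun t : ℝ => t ^ (-(1 / p))) volume 0 1 := by
      apply intervalIntegral.intervalIntegrable_rpow'
      rw [neg_lt_neg_iff, div_lt_one (by linarith)]
      exact hp
    simpa using (h0.comp_sub_left 1).symm
  -- Since t^p ≤ t on [0, 1], the weight is dominated by (1 - t)^(-1/p), integrable because 1/p < 1.
  -- At t = 1 the two sides coincide.
  refine h.mono_fun (Measurable.aestronglyMeasurable (by fun_prop)) ?_
  rw [uIoc_of_le zero_le_one]
  filter_upwards [ae_restrict_mem measurableSet_Ioc] with t ht
  rw [Real.norm_of_nonneg (rpow_weight_nonneg hp ht.1.le ht.2),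
    Real.norm_of_nonneg (Real.rpow_nonneg (sub_nonneg.2 ht.2) _)]
  rcases ht.2.eq_or_lt with rfl | h1
  · simp
  · refine Real.rpow_le_rpow_of_nonpos (by linarith) (sub_le_sub_left ?_ 1)
      (neg_nonpos.2 (by positivity))
    simpa using Real.rpow_le_rpow_of_exponent_ge ht.1 ht.2 hp.le

lemma intervalIntegrable_rpow_weight_sub (hp : 1 < p) {a b : ℝ} (ha : a ∈ Icc (0 : ℝ) 1)
    (hb : b ∈ Icc (0 : ℝ) 1) :
    IntervalIntegrable (fun t : ℝ => (1 - t ^ p) ^ (-(1 / p))) volume a b := by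
  apply (intervalIntegrable_rpow_weight hp).mono_set
  rw [uIcc_of_le zero_le_one]
  exact uIcc_subset_Icc ha hb

@[simp] lemma pArcsin_zero : pArcsin p 0 = 0 := by simp [pArcsin]

lemma sub_le_pArcsin_sub (hp : 1 < p) {a b : ℝ} (ha : 0 ≤ a) (hab : a ≤ b) (hb : b ≤ 1) :
    b - a ≤ pArcsin p b - pArcsin p a := by
  have h0 : (0 : ℝ) ∈ Icc (0 : ℝ) 1 := by simp
  have ha' : a ∈ Icc (0 : ℝ) 1 := ⟨ha, hab.trans hb⟩
  have hb' : b ∈ Icc (0 : ℝ) 1 := ⟨ha.trans hab, hb⟩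
  rw [pArcsin, pArcsin, intervalIntegral.integral_interval_sub_left
    (intervalIntegrable_rpow_weight_sub hp h0 hb') (intervalIntegrable_rpow_weight_sub hp h0 ha')]
  have h1 : b - a = ∫ _ in a..b, (1 : ℝ) := by simp
  rw [h1]
  refine intervalIntegral.integral_mono_on_of_le_Ioo hab (by simp)
    (intervalIntegrable_rpow_weight_sub hp ha' hb') fun t ht => ?_
  exact one_le_rpow_weight hp (ha.trans ht.1.le) (ht.2.trans_le hb)

lemma strictMonoOn_pArcsin (hp : 1 < p) : StrictMonoOn (pArcsin p) (Icc 0 1) := by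
  intro a ha b hb hab
  have := sub_le_pArcsin_sub hp ha.1 hab.le hb.2
  linarith

lemma continuousOn_pArcsin (hp : 1 < p) : ContinuousOn (pArcsin p) (Icc 0 1) := by
  have := intervalIntegral.continuousOn_primitive_interval
    (f := fun t : ℝ => (1 - t ^ p) ^ (-(1 / p))) (μ := volume) (a := 0) (b := 1)
  rw [uIcc_of_le zero_le_one] at this
  exact this ((intervalIntegrable_iff_integrableOn_Icc_of_le zero_le_one).1
    (intervalIntegrable_rpow_weight hp))

/-- F_p(c)/c is the mean of an increasing weight over [0, c], so it increases with c. Equivalently,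
sin_p x / x decreases on the first quarter period. -/
lemma pArcsin_mul_le (hp : 1 < p) {a b : ℝ} (ha : 0 < a) (hab : a ≤ b) (hb : b ≤ 1) :
    pArcsin p a * b ≤ pArcsin p b * a := by
  have key : ∀ c : ℝ, 0 < c → pArcsin p c =
      c * ∫ t in (0 : ℝ)..1, (1 - (c * t) ^ p) ^ (-(1 / p)) := by
    intro c hc
    rw [intervalIntegral.integral_comp_mul_left (fun t : ℝ => (1 - t ^ p) ^ (-(1 / p))) hc.ne']
    simp [pArcsin, hc.ne']
  have hint : ∀ c : ℝ, 0 < c → c ≤ 1 →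
      IntervalIntegrable (fun t : ℝ => (1 - (c * t) ^ p) ^ (-(1 / p))) volume 0 1 := by
    intro c hc hc1
    have := (intervalIntegrable_rpow_weight_sub hp (a := 0) (b := c) (by simp)
      ⟨hc.le, hc1⟩).comp_mul_left (c := c)
    simpa [hc.ne'] using this
  have hb0 := ha.trans_le hab
  rw [key a ha, key b hb0]
  have : ∫ t in (0 : ℝ)..1, (1 - (a * t) ^ p) ^ (-(1 / p)) ≤
      ∫ t in (0 : ℝ)..1, (1 - (b * t) ^ p) ^ (-(1 / p)) := by
    refine intervalIntegral.integral_mono_on_of_le_Ioo zero_le_one (hint a ha (hab.trans hb))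
      (hint b hb0 hb) fun t ht => ?_
    refine rpow_weight_mono hp (mul_nonneg ha.le ht.1.le)
      (mul_le_mul_of_nonneg_right hab ht.1.le) ?_
    nlinarith [ht.1, ht.2]
  nlinarith [mul_le_mul_of_nonneg_left this (mul_pos ha hb0).le]

lemma one_le_half_pPi (hp : 1 < p) : 1 ≤ pPi p / 2 := by
  have := sub_le_pArcsin_sub hp le_rfl zero_le_one le_rfl
  simp only [pArcsin_zero] at this
  simp only [pPi]; linarith

lemma pArcsin_one : pArcsin p 1 = pPi p / 2 := by simp [pPi]

lemma exists_pArcsin_eq (hp : 1 < p) {x : ℝ} (hx : x ∈ Icc 0 (pPi p / 2)) :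
    ∃ y ∈ Icc (0 : ℝ) 1, pArcsin p y = x := by
  have := intermediate_value_Icc zero_le_one (continuousOn_pArcsin hp)
  rw [pArcsin_zero, pArcsin_one] at this
  exact this hx

lemma pSinQuarter_mem (hp : 1 < p) {x : ℝ} (hx : x ∈ Icc 0 (pPi p / 2)) :
    pSinQuarter p x ∈ Icc (0 : ℝ) 1 :=
  Function.invFunOn_mem (exists_pArcsin_eq hp hx)

lemma pArcsin_pSinQuarter (hp : 1 < p) {x : ℝ} (hx : x ∈ Icc 0 (pPi p / 2)) :
    pArcsin p (pSinQuarter p x) = x :=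
  Function.invFunOn_eq (exists_pArcsin_eq hp hx)

lemma pArcsin_mem (hp : 1 < p) {y : ℝ} (hy : y ∈ Icc (0 : ℝ) 1) :
    pArcsin p y ∈ Icc 0 (pPi p / 2) := by
  have hm := (strictMonoOn_pArcsin hp).monotoneOn
  constructor
  · simpa using hm (by simp) hy hy.1
  · rw [← pArcsin_one]; exact hm hy (by simp) hy.2

lemma pSinQuarter_pArcsin (hp : 1 < p) {y : ℝ} (hy : y ∈ Icc (0 : ℝ) 1) :
    pSinQuarter p (pArcsin p y) = y :=
  (strictMonoOn_pArcsin hp).injOn (pSinQuarter_mem hp (pArcsin_mem hp hy)) hy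
    (pArcsin_pSinQuarter hp (pArcsin_mem hp hy))

lemma monotoneOn_pSinQuarter (hp : 1 < p) : MonotoneOn (pSinQuarter p) (Icc 0 (pPi p / 2)) := by
  intro x hx y hy hxy
  rw [← (strictMonoOn_pArcsin hp).le_iff_le (pSinQuarter_mem hp hx) (pSinQuarter_mem hp hy),
    pArcsin_pSinQuarter hp hx, pArcsin_pSinQuarter hp hy]
  exact hxy

lemma pReduce_mem (hp : 1 < p) (x : ℝ) : -(pPi p / 2) ≤ pReduce p x ∧
    pReduce p x ≤ 3 * (pPi p / 2) := by
  have hpi := one_le_half_pPi hp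
  have h2 : 0 < 2 * pPi p := by linarith
  have h3 := Int.floor_le ((x + pPi p / 2) / (2 * pPi p))
  have h4 := (Int.lt_floor_add_one ((x + pPi p / 2) / (2 * pPi p))).le
  rw [le_div_iff₀ h2] at h3
  rw [div_le_iff₀ h2] at h4
  simp only [pReduce]
  constructor <;> nlinarith

lemma pReduce_of_mem (hp : 1 < p) {x : ℝ} (hx : x ∈ Icc 0 (pPi p / 2)) : pReduce p x = x := by
  have hpi := one_le_half_pPi hp
  have h2 : 0 < 2 * pPi p := by linarith
  have : ⌊(x + pPi p / 2) / (2 * pPi p)⌋ = 0 := by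
    rw [Int.floor_eq_zero_iff]
    refine ⟨div_nonneg (by linarith [hx.1]) h2.le, ?_⟩
    rw [div_lt_one h2]; linarith [hx.2]
  simp [pReduce, this]

lemma pSin_of_mem (hp : 1 < p) {x : ℝ} (hx : x ∈ Icc 0 (pPi p / 2)) :
    pSin p x = pSinQuarter p x := by
  simp [pSin, pReduce_of_mem hp hx, hx.2, pSinHalf, hx.1]

lemma abs_pSinHalf_le_one (hp : 1 < p) {x : ℝ} (hx : |x| ≤ pPi p / 2) : |pSinHalf p x| ≤ 1 := by
  have hx' := abs_le.1 hx
  unfold pSinHalf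
  split_ifs with h
  · have := pSinQuarter_mem hp ⟨h, hx'.2⟩
    rw [abs_of_nonneg this.1]; exact this.2
  · have := pSinQuarter_mem hp (x := -x) ⟨by linarith, by linarith⟩
    rw [abs_neg, abs_of_nonneg this.1]; exact this.2

lemma abs_pSin_le_one (hp : 1 < p) (x : ℝ) : |pSin p x| ≤ 1 := by
  have h := pReduce_mem hp x
  unfold pSin
  split_ifs with h1
  · exact abs_pSinHalf_le_one hp (abs_le.2 ⟨h.1, h1⟩)
  · push Not at h1
    exact abs_pSinHalf_le_one hp (abs_le.2 ⟨by linarith, by linarith⟩)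

lemma measurable_pSin (hp : 1 < p) : Measurable (pSin p) := by
  have hpi := one_le_half_pPi hp
  -- Clamping the argument to the quarter period gives a function monotone on all of ℝ, hence
  -- measurable.
  set S : ℝ → ℝ := fun x => pSinQuarter p (max 0 (min x (pPi p / 2))) with hS
  have hSmono : Monotone S := by
    intro x y hxy
    apply monotoneOn_pSinQuarter hp
    · exact ⟨le_max_left _ _, max_le (by linarith) (min_le_right _ _)⟩
    · exact ⟨le_max_left _ _, max_le (by linarith) (min_le_right _ _)⟩
    · gcongr
  have hSm := hSmono.measurable
  set T : ℝ → ℝ := fun x => if 0 ≤ x then S x else -S (-x) with hT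
  have hTm : Measurable T :=
    Measurable.ite measurableSet_Ici hSm (hSm.comp measurable_neg).neg
  have hTe : ∀ x, |x| ≤ pPi p / 2 → pSinHalf p x = T x := by
    intro x hx
    have hx' := abs_le.1 hx
    simp only [hT, hS, pSinHalf]
    split_ifs with h
    · rw [min_eq_left hx'.2, max_eq_right h]
    · rw [min_eq_left (by linarith), max_eq_right (by linarith)]
  have hR : Measurable (pReduce p) := by unfold pReduce; fun_prop
  have : pSin p = fun x => if pReduce p x ≤ pPi p / 2 then T (pReduce p x)
      else T (pPi p - pReduce p x) := by
    ext x
    have h := pReduce_mem hp x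
    unfold pSin
    split_ifs with h1
    · exact hTe _ (abs_le.2 ⟨h.1, h1⟩)
    · push Not at h1
      exact hTe _ (abs_le.2 ⟨by linarith, by linarith⟩)
  rw [this]
  exact Measurable.ite (measurableSet_le hR measurable_const) (hTm.comp hR)
    (hTm.comp (measurable_const.sub hR))

lemma measurable_pSin_div_rpow (hp : 1 < p) (q : ℝ) :
    Measurable fun x : ℝ => |pSin p x / x| ^ q := by
  have := measurable_pSin hp
  exact ((this.div measurable_id).abs).pow_const q

lemma pSin_mul_le (hp : 1 < p) {y x : ℝ} (hy : y ∈ Ioc (0 : ℝ) 1) (hyx : pArcsin p y ≤ x)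
    (hx : x ≤ pPi p / 2) : pSin p x * pArcsin p y ≤ y * x := by
  have hy' : y ∈ Icc (0 : ℝ) 1 := Ioc_subset_Icc_self hy
  have hx' : x ∈ Icc 0 (pPi p / 2) := ⟨(pArcsin_mem hp hy').1.trans hyx, hx⟩
  have h := pSinQuarter_mem hp hx'
  have h2 : y ≤ pSinQuarter p x := by
    rw [← (strictMonoOn_pArcsin hp).le_iff_le hy' h, pArcsin_pSinQuarter hp hx']
    exact hyx
  have := pArcsin_mul_le hp hy.1 h2 h.2
  rw [pArcsin_pSinQuarter hp hx'] at this
  rw [pSin_of_mem hp hx']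
  linarith

lemma abs_pSin_div_le_one (hp : 1 < p) {x : ℝ} (hx : 0 < x) : |pSin p x / x| ≤ 1 := by
  rw [abs_div, abs_of_pos hx, div_le_one hx]
  rcases le_or_gt x (pPi p / 2) with h | h
  · have hx' : x ∈ Icc 0 (pPi p / 2) := ⟨hx.le, h⟩
    have hm := pSinQuarter_mem hp hx'
    rw [pSin_of_mem hp hx', abs_of_nonneg hm.1]
    have := sub_le_pArcsin_sub hp le_rfl hm.1 hm.2
    rw [pArcsin_pSinQuarter hp hx', pArcsin_zero] at this
    linarith
  · exact (abs_pSin_le_one hp x).trans ((one_le_half_pPi hp).trans h.le)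

/-- The integrand is at most 1 on (0, 1] and at most x^(-q) beyond. -/
lemma integrableOn_abs_pSin_div_rpow (hp : 1 < p) {q : ℝ} (hq : 1 < q) :
    IntegrableOn (fun x : ℝ => |pSin p x / x| ^ q) (Ioi 0) := by
  have hm := measurable_pSin_div_rpow hp q
  rw [← Ioc_union_Ioi_eq_Ioi (zero_le_one : (0 : ℝ) ≤ 1)]
  refine IntegrableOn.union ?_ ?_
  · refine Measure.integrableOn_of_bounded (M := 1) (by simp) hm.aestronglyMeasurable ?_
    filter_upwards [ae_restrict_mem measurableSet_Ioc] with x hx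
    rw [Real.norm_of_nonneg (by positivity)]
    exact Real.rpow_le_one (abs_nonneg _) (abs_pSin_div_le_one hp hx.1) (by linarith)
  · refine (integrableOn_Ioi_rpow_of_lt (a := -q) (by linarith) one_pos).mono'
      hm.aestronglyMeasurable ?_
    filter_upwards [ae_restrict_mem measurableSet_Ioi] with x hx
    have hx0 : (0 : ℝ) < x := zero_lt_one.trans hx
    rw [Real.norm_of_nonneg (by positivity), Real.rpow_neg hx0.le, ← Real.inv_rpow hx0.le]
    refine Real.rpow_le_rpow (abs_nonneg _) ?_ (by linarith)
    rw [abs_div, abs_of_pos hx0, div_eq_mul_inv]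
    exact mul_le_of_le_one_left (by positivity) (abs_pSin_le_one hp x)

end Arcsin

/-! ### Power series of `pArcsin` at the origin. -/

section ArcsinSeries

variable {p : ℝ}

lemma exists_hasSum_one_sub_rpow_neg (a : ℝ) : ∃ c : ℕ → ℝ, c 0 = 1 ∧ c 1 = a ∧
    c 2 = a * (a + 1) / 2 ∧
    ∀ v : ℝ, |v| < 1 → HasSum (fun n => c n * v ^ n) ((1 - v) ^ (-a)) := by
  refine ⟨fun n => Ring.choose (a + n - 1) n, by simp, by simp, ?_, fun v hv => ?_⟩
  · have := Ring.descPochhammer_eq_factorial_smul_choose (a + 1) 2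
    simp [descPochhammer_succ_right, Polynomial.smeval_mul, Polynomial.smeval_sub,
      Polynomial.smeval_X] at this
    simp only [Nat.cast_ofNat]
    rw [show a + 2 - 1 = a + 1 by ring]
    linarith
  · have h := (Real.one_div_one_sub_rpow_hasFPowerSeriesOnBall_zero a).hasSum (y := v)
      (by simpa [enorm_eq_nnnorm] using! hv)
    have h1 : 0 ≤ 1 - v := by linarith [(abs_lt.1 hv).2]
    rw [Real.rpow_neg h1]
    simpa [mul_comm] using h

/-- The power series `G` with `F_p(y) = y * G (y ^ p)` near `0`. -/
lemma exists_analyticAt_pArcsin_eq (hp : 1 < p) : ∃ G : ℝ → ℝ, AnalyticAt ℝ G 0 ∧ G 0 = 1 ∧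
    deriv G 0 = 1 / (p * (p + 1)) ∧
    deriv (dslope G 0) 0 = (p + 1) / (2 * p ^ 2 * (2 * p + 1)) ∧
    ∀ y ∈ Ioo (0 : ℝ) 1, pArcsin p y = y * G (y ^ p) := by
  have hp0 : 0 < p := by linarith
  obtain ⟨c, c0, c1, c2, hc⟩ := exists_hasSum_one_sub_rpow_neg (1 / p)
  have hpos : ∀ n : ℕ, (1 : ℝ) ≤ p * n + 1 := fun n => by
    have : 0 ≤ p * (n : ℝ) := by positivity
    linarith
  -- Integrating c n * t^(p n) over [0, y] yields y * (y^p)^n * c n / (p n + 1).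
  set d : ℕ → ℝ := fun n => c n / (p * n + 1) with hd
  set G : ℝ → ℝ := fun u => ∑' n, d n * u ^ n with hG
  have hsum : ∀ u : ℝ, |u| < 1 → HasSum (fun n => d n * u ^ n) (G u) := by
    intro u hu
    refine Summable.hasSum (Summable.of_norm_bounded (hc u hu).summable.abs fun n => ?_)
    rw [Real.norm_eq_abs, abs_mul, abs_mul, hd]
    simp only [abs_div]
    rw [abs_of_pos (zero_lt_one.trans_le (hpos n))]
    exact mul_le_mul_of_nonneg_right (div_le_self (abs_nonneg _) (hpos n)) (abs_nonneg _)
  have hGs : HasFPowerSeriesAt G (FormalMultilinearSeries.ofScalars ℝ d) 0 := by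
    rw [hasFPowerSeriesAt_iff]
    filter_upwards [Metric.ball_mem_nhds (0 : ℝ) one_pos] with u hu
    have := hsum u (by simpa using hu)
    simpa [FormalMultilinearSeries.coeff_ofScalars, mul_comm] using this
  refine ⟨G, hGs.analyticAt, ?_, ?_, ?_, ?_⟩
  · rw [← hGs.coeff_zero 1]
    simp [hd, c0]
  · have h1 : deriv G 0 = d 1 := by
      rw [hGs.deriv]
      exact FormalMultilinearSeries.coeff_ofScalars
    rw [h1]
    simp only [hd, c1, Nat.cast_one, mul_one]
    rw [div_div]
  · have h2 : deriv (dslope G 0) 0 = d 2 := by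
      rw [hGs.has_fpower_series_dslope_fslope.deriv]
      simp [FormalMultilinearSeries.coeff_fslope, FormalMultilinearSeries.coeff_ofScalars]
    rw [h2]
    simp only [hd, c2, Nat.cast_ofNat]
    have : p * 2 + 1 ≠ 0 := by positivity
    have : 2 * p + 1 ≠ 0 := by positivity
    field_simp
    ring
  · intro y hy
    have hyp0 : 0 ≤ y ^ p := Real.rpow_nonneg hy.1.le _
    have hyp : |y ^ p| < 1 := by
      rw [abs_of_nonneg hyp0]
      exact Real.rpow_lt_one hy.1.le hy.2 hp0
    -- Termwise integration: each term is dominated by its absolute value at t = y, which is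
    -- summable since y^p < 1.
    have h1 : HasSum (fun n : ℕ => ∫ t in (0 : ℝ)..y, c n * (t ^ p) ^ n) (pArcsin p y) := by
      refine intervalIntegral.hasSum_integral_of_dominated_convergence
        (fun n _ => |c n * (y ^ p) ^ n|) (fun n => Measurable.aestronglyMeasurable (by fun_prop))
        (fun n => .of_forall fun t ht => ?_) (.of_forall fun t _ => (hc _ hyp).summable.abs)
        (by simp) (.of_forall fun t ht => ?_)
      · rw [uIoc_of_le hy.1.le] at ht
        rw [Real.norm_eq_abs, abs_mul, abs_mul]
        have ht0 : 0 ≤ t ^ p := Real.rpow_nonneg ht.1.le _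
        rw [abs_of_nonneg (pow_nonneg ht0 n), abs_of_nonneg (pow_nonneg hyp0 n)]
        gcongr
        exacts [ht.1.le, ht.2]
      · rw [uIoc_of_le hy.1.le] at ht
        apply hc
        rw [abs_of_nonneg (Real.rpow_nonneg ht.1.le _)]
        exact Real.rpow_lt_one ht.1.le (ht.2.trans_lt hy.2) hp0
    have h2 : ∀ n : ℕ, ∫ t in (0 : ℝ)..y, c n * (t ^ p) ^ n = y * (d n * (y ^ p) ^ n) := by
      intro n
      have h3 : ∫ t in (0 : ℝ)..y, c n * (t ^ p) ^ n = ∫ t in (0 : ℝ)..y, c n * t ^ (p * n) := by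
        refine intervalIntegral.integral_congr fun t ht => ?_
        rw [uIcc_of_le hy.1.le] at ht
        simp only [Real.rpow_mul ht.1, Real.rpow_natCast]
      have h4 : (0 : ℝ) ≤ p * n := by positivity
      rw [h3, intervalIntegral.integral_const_mul, integral_rpow (Or.inl (by linarith)),
        Real.zero_rpow (by linarith [hpos n]), Real.rpow_add hy.1, Real.rpow_one,
        Real.rpow_mul hy.1.le, Real.rpow_natCast]
      simp only [hd]
      ring
    simp only [h2] at h1
    exact h1.unique ((hsum _ hyp).mul_left y)

end ArcsinSeries

/-! ### Analytic inversion in the variable s. -/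

section Inversion

/-- Second-order Taylor data are carried by difference quotients: for f analytic at 0, the
derivative of `dslope f 0` at 0 is the coefficient of the quadratic term of f. -/
lemma AnalyticAt.dslope_self {f : ℝ → ℝ} {x : ℝ} (hf : AnalyticAt ℝ f x) :
    AnalyticAt ℝ (dslope f x) x :=
  hf.hasFPowerSeriesAt.has_fpower_series_dslope_fslope.analyticAt

lemma deriv_dslope_exp : deriv (dslope Real.exp 0) 0 = 1 / 2 := by
  have h : AnalyticAt ℝ Real.exp 0 := analyticAt_rexp
  rw [h.hasFPowerSeriesAt.has_fpower_series_dslope_fslope.deriv]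
  simp [FormalMultilinearSeries.coeff_fslope, FormalMultilinearSeries.coeff_ofScalars,
    iteratedDeriv_eq_iterate, Nat.factorial]

lemma mul_dslope_zero (f : ℝ → ℝ) (u : ℝ) : f u = f 0 + u * dslope f 0 u := by
  have := sub_smul_dslope f 0 u
  simp only [sub_zero, smul_eq_mul] at this
  linarith

/-- The analytic solution `u = s * m s` of `G u = exp s`. -/
lemma exists_analyticAt_comp_mul_eq_exp {G : ℝ → ℝ} (hG : AnalyticAt ℝ G 0) (hG0 : G 0 = 1)
    (hG1 : deriv G 0 ≠ 0) : ∃ m : ℝ → ℝ, AnalyticAt ℝ m 0 ∧ m 0 = (deriv G 0)⁻¹ ∧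
      deriv m 0 * deriv G 0 + m 0 ^ 2 * deriv (dslope G 0) 0 = 1 / 2 ∧
      ∀ᶠ s in 𝓝 0, G (s * m s) = Real.exp s := by
  have hstr := hG.hasStrictDerivAt
  set L := hstr.localInverse _ _ _ hG1 with hL
  have hLan : AnalyticAt ℝ L 1 := by
    rw [← hG0]; exact hG.analyticAt_localInverse hG1
  have hL1 : L 1 = 0 := by
    rw [← hG0]; exact HasStrictFDerivAt.localInverse_apply_image ..
  have hLd : HasDerivAt L (deriv G 0)⁻¹ 1 := by
    have := (hstr.to_localInverse hG1).hasDerivAt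
    rwa [hG0] at this
  have hLr : ∀ᶠ w in 𝓝 1, G (L w) = w := by
    have := hstr.eventually_right_inverse hG1
    rwa [hG0] at this
  have hexp : AnalyticAt ℝ Real.exp 0 := analyticAt_rexp
  -- U solves G(U(s)) = exp s and vanishes at 0, so its difference quotient is the required m.
  set U : ℝ → ℝ := fun s => L (Real.exp s) with hU
  have hUan : AnalyticAt ℝ U 0 := by
    refine AnalyticAt.fun_comp ?_ hexp
    rwa [Real.exp_zero]
  have hU0 : U 0 = 0 := by simp [hU, hL1]
  have hUd : HasDerivAt U (deriv G 0)⁻¹ 0 := by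
    have h1 : HasDerivAt L (deriv G 0)⁻¹ (Real.exp 0) := by rwa [Real.exp_zero]
    have := h1.comp 0 (Real.hasDerivAt_exp 0)
    rwa [Real.exp_zero, mul_one] at this
  have hUe : ∀ᶠ s in 𝓝 0, G (U s) = Real.exp s := by
    have : Tendsto Real.exp (𝓝 0) (𝓝 1) := by
      simpa using (Real.continuous_exp.tendsto 0)
    exact this.eventually hLr
  have hm : AnalyticAt ℝ (dslope U 0) 0 := hUan.dslope_self
  have hUm : ∀ s, U s = s * dslope U 0 s := fun s => by
    simpa [hU0] using mul_dslope_zero U s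
  have hm0 : dslope U 0 0 = (deriv G 0)⁻¹ := by rw [dslope_same, hUd.deriv]
  have hev : ∀ᶠ s in 𝓝 0, G (s * dslope U 0 s) = Real.exp s := by
    filter_upwards [hUe] with s hs
    rw [← hUm, hs]
  refine ⟨dslope U 0, hm, hm0, ?_, hev⟩
  -- With u = s m(s), this is (G(u) - 1)/s = (exp s - 1)/s. Its derivative at 0 is the relation
  -- between m'(0) and the quadratic coefficient of G; the 1/2 comes from the exponential.
  have heq : (fun s => dslope U 0 s * dslope G 0 (s * dslope U 0 s)) =ᶠ[𝓝 0]
      dslope Real.exp 0 := by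
    filter_upwards [hev] with s hs
    rcases eq_or_ne s 0 with rfl | h0
    · rw [zero_mul, hm0, dslope_same, dslope_same, inv_mul_cancel₀ hG1]
      simp
    · have h1 := mul_dslope_zero G (s * dslope U 0 s)
      have h2 := mul_dslope_zero Real.exp s
      rw [hs, hG0] at h1
      rw [Real.exp_zero] at h2
      have h3 : s * (dslope U 0 s * dslope G 0 (s * dslope U 0 s)) =
          s * dslope Real.exp 0 s := by linarith
      exact mul_left_cancel₀ h0 h3
  have hmd := hm.differentiableAt.hasDerivAt
  have hin : HasDerivAt (fun s => s * dslope U 0 s) (dslope U 0 0) 0 := by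
    have := (hasDerivAt_id' (0 : ℝ)).fun_mul hmd
    rwa [one_mul, zero_mul, add_zero] at this
  have hgd : HasDerivAt (dslope G 0) (deriv (dslope G 0) 0) (0 * dslope U 0 0) := by
    rw [zero_mul]; exact hG.dslope_self.differentiableAt.hasDerivAt
  have hd := (hmd.mul (hgd.comp 0 hin)).deriv
  have h4 := heq.deriv_eq
  rw [deriv_dslope_exp] at h4
  change deriv (fun s => dslope U 0 s * dslope G 0 (s * dslope U 0 s)) 0 = _ at hd
  rw [h4] at hd
  simp only [Function.comp_apply, zero_mul, dslope_same G] at hd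
  rw [hd]
  ring

/-- In the variable `s = log (x / sin_p x)` one has `x = s ^ (1 / p) * k s` with `k` analytic. -/
lemma exists_analyticAt_pArcsin_param {p : ℝ} (hp : 1 < p) : ∃ k : ℝ → ℝ, AnalyticAt ℝ k 0 ∧
    k 0 = (p * (p + 1)) ^ (1 / p) ∧
    deriv k 0 = k 0 * ((-p ^ 2 + p + 1) / (2 * (2 * p + 1))) ∧
    ∀ᶠ s in 𝓝[>] 0, ∃ y ∈ Ioo (0 : ℝ) 1, pArcsin p y = s ^ (1 / p) * k s ∧
      s ^ (1 / p) * k s = y * Real.exp s := by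
  have hp0 : 0 < p := by linarith
  obtain ⟨G, hG, hG0, hG1, hG2, hGF⟩ := exists_analyticAt_pArcsin_eq hp
  obtain ⟨m, hm, hm0, hm1, hmG⟩ := exists_analyticAt_comp_mul_eq_exp hG hG0
    (by rw [hG1]; positivity)
  rw [hG1] at hm0 hm1
  rw [one_div, inv_inv] at hm0
  have hmpos : 0 < m 0 := by rw [hm0]; positivity
  have hlog : AnalyticAt ℝ (fun s => Real.log (m s)) 0 := hm.log hmpos
  have hinner : AnalyticAt ℝ (fun s => Real.log (m s) * (1 / p) + s) 0 :=
    (hlog.mul analyticAt_const).add analyticAt_id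
  -- This is m(s)^(1/p) exp s, written through the logarithm so that analyticity and the derivative
  -- at 0 are immediate. The matching y is (s m(s))^(1/p).
  refine ⟨fun s => Real.exp (Real.log (m s) * (1 / p) + s), hinner.rexp, ?_, ?_, ?_⟩
  · beta_reduce
    rw [add_zero, ← Real.rpow_def_of_pos hmpos, hm0]
  · have h1 := ((hm.differentiableAt.hasDerivAt.log hmpos.ne').mul_const (1 / p)).add
      (hasDerivAt_id (0 : ℝ))
    have h2 : HasDerivAt (fun s => Real.exp (Real.log (m s) * (1 / p) + s))
      (Real.exp (Real.log (m 0) * (1 / p) + 0) * (deriv m 0 / m 0 * (1 / p) + 1)) 0 := h1.exp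
    rw [h2.deriv]
    congr 1
    have h3 : deriv m 0 = p * (p + 1) * (1 / 2 -
        (p * (p + 1)) ^ 2 * ((p + 1) / (2 * p ^ 2 * (2 * p + 1)))) := by
      rw [hG2, hm0] at hm1
      have : p * (p + 1) ≠ 0 := by positivity
      have h4 : deriv m 0 = p * (p + 1) * (deriv m 0 * (1 / (p * (p + 1)))) := by
        field_simp
      rw [h4]
      congr 1
      linarith
    have : 2 * p + 1 ≠ 0 := by positivity
    have : p + 1 ≠ 0 := by positivity
    rw [h3, hm0]
    field_simp
    ring
  · have hc : ContinuousAt (fun s => s * m s) 0 := continuousAt_id.mul hm.continuousAt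
    have hlt : ∀ᶠ s in 𝓝 0, s * m s < 1 := by
      refine hc.eventually_lt continuousAt_const ?_
      simp
    filter_upwards [self_mem_nhdsWithin, hlt.filter_mono nhdsWithin_le_nhds,
      hmG.filter_mono nhdsWithin_le_nhds, (hm.continuousAt.eventually_const_lt hmpos).filter_mono
        nhdsWithin_le_nhds] with s hs0 hs1 hs2 hs3
    rw [mem_Ioi] at hs0
    have hpos : 0 < s * m s := mul_pos hs0 hs3
    have hy : (s * m s) ^ (1 / p) ∈ Ioo (0 : ℝ) 1 :=
      ⟨Real.rpow_pos_of_pos hpos _, Real.rpow_lt_one hpos.le hs1 (by positivity)⟩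
    have hyp : ((s * m s) ^ (1 / p)) ^ p = s * m s := by
      rw [← Real.rpow_mul hpos.le, one_div_mul_cancel hp0.ne', Real.rpow_one]
    have hX : s ^ (1 / p) * Real.exp (Real.log (m s) * (1 / p) + s) =
        (s * m s) ^ (1 / p) * Real.exp s := by
      rw [Real.exp_add, ← Real.rpow_def_of_pos hs3, Real.mul_rpow hs0.le hs3.le, mul_assoc]
    refine ⟨_, hy, ?_, hX⟩
    rw [hGF _ hy, hyp, hs2, hX]

end Inversion

/-! ### Watson's lemma for exponentially damped power integrals. -/

section Watson

lemma integrableOn_exp_neg_mul_rpow {a q : ℝ} (ha : 0 < a) (hq : 0 < q) :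
    IntegrableOn (fun s : ℝ => s ^ (a - 1) * Real.exp (-(q * s))) (Ioi 0) := by
  have := integrableOn_rpow_mul_exp_neg_mul_rpow (p := 1) (s := a - 1) (b := q)
    (by linarith) one_pos hq
  simpa [neg_mul] using this

lemma isBigO_rpow_mul_exp_neg {b s₀ : ℝ} (hs : 0 < s₀) (n : ℕ) :
    (fun q : ℝ => q ^ b * Real.exp (-(q * s₀))) =O[atTop] fun q : ℝ => 1 / q ^ n := by
  have h := (isLittleO_exp_neg_mul_rpow_atTop hs (-(n : ℝ) - b)).isBigO
  have h2 := (isBigO_refl (fun q : ℝ => q ^ b) atTop).mul h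
  refine (h2.congr' ?_ ?_)
  · exact .of_forall fun q => by simp only [neg_mul, mul_comm q s₀]
  · filter_upwards [eventually_gt_atTop 0] with q hq
    rw [← Real.rpow_add hq, show b + (-(n : ℝ) - b) = -(n : ℝ) by ring, Real.rpow_neg hq.le,
      Real.rpow_natCast, one_div]

/-- For q ≥ 1 and s > s₀, exp(-(q - 1) s) ≤ exp(-(q - 1) s₀), which leaves a convergent integral
independent of q. -/
lemma isBigO_setIntegral_Ioi_rpow_mul_exp_neg {a s₀ : ℝ} (ha : 0 < a) (hs : 0 < s₀) :
    (fun q : ℝ => ∫ s in Ioi s₀, s ^ (a - 1) * Real.exp (-(q * s))) =O[atTop]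
      fun q : ℝ => Real.exp (-(q * s₀)) := by
  set J := ∫ s in Ioi (0 : ℝ), s ^ (a - 1) * Real.exp (-(1 * s)) with hJ
  refine IsBigO.of_bound (J * Real.exp s₀) ?_
  filter_upwards [eventually_ge_atTop 1] with q hq
  have hsub : Ioi s₀ ⊆ Ioi (0 : ℝ) := Ioi_subset_Ioi hs.le
  have hi := integrableOn_exp_neg_mul_rpow ha (q := 1) one_pos
  have hnn : ∀ (r s : ℝ), 0 < s → 0 ≤ s ^ (a - 1) * Real.exp (-(r * s)) := fun r s hs' =>
    mul_nonneg (Real.rpow_nonneg hs'.le _) (Real.exp_nonneg _)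
  rw [Real.norm_of_nonneg (setIntegral_nonneg measurableSet_Ioi fun s h => hnn q s (hsub h)),
    Real.norm_of_nonneg (Real.exp_nonneg _)]
  calc ∫ s in Ioi s₀, s ^ (a - 1) * Real.exp (-(q * s))
      ≤ ∫ s in Ioi s₀, (s ^ (a - 1) * Real.exp (-(1 * s))) * Real.exp (-((q - 1) * s₀)) := by
        refine setIntegral_mono_on
          ((integrableOn_exp_neg_mul_rpow ha (by linarith)).mono_set hsub)
          ((hi.mono_set hsub).mul_const _) measurableSet_Ioi fun s h => ?_
        rw [mul_assoc, ← Real.exp_add]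
        refine mul_le_mul_of_nonneg_left (Real.exp_le_exp.2 ?_) (Real.rpow_nonneg (hsub h).le _)
        nlinarith [mem_Ioi.1 h]
    _ = (∫ s in Ioi s₀, s ^ (a - 1) * Real.exp (-(1 * s))) * Real.exp (-((q - 1) * s₀)) :=
        integral_mul_const _ _
    _ ≤ J * Real.exp (-((q - 1) * s₀)) := by
        refine mul_le_mul_of_nonneg_right ?_ (Real.exp_nonneg _)
        refine setIntegral_mono_set hi ?_ hsub.eventuallyLE
        filter_upwards [ae_restrict_mem measurableSet_Ioi] with s h using hnn 1 s h
    _ = J * Real.exp s₀ * Real.exp (-(q * s₀)) := by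
        rw [mul_assoc, ← Real.exp_add]; congr 2; ring

/-- Watson's lemma on a finite interval. -/
lemma watson {a s₀ : ℝ} (ha : 0 < a) (hs : 0 < s₀) {h : ℝ → ℝ}
    (hm : AEStronglyMeasurable h (volume.restrict (Ioo 0 s₀))) (c : ℕ → ℝ) (n : ℕ) {C : ℝ}
    (hC : ∀ s ∈ Ioo 0 s₀, |h s - ∑ j ∈ Finset.range n, c j * s ^ j| ≤ C * s ^ n) :
    (fun q : ℝ => q ^ a * (∫ s in Ioo 0 s₀, s ^ (a - 1) * h s * Real.exp (-(q * s)))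
      - ∑ j ∈ Finset.range n, Real.Gamma (j + a) * c j / q ^ j) =O[atTop]
      fun q : ℝ => 1 / q ^ n := by
  set K : ℕ → ℝ → ℝ → ℝ := fun j q s => s ^ (a + j - 1) * Real.exp (-(q * s)) with hK
  have haj : ∀ j : ℕ, 0 < a + j := fun j => by positivity
  have hKi : ∀ j : ℕ, ∀ q : ℝ, 0 < q → IntegrableOn (K j q) (Ioi 0) := fun j q hq =>
    integrableOn_exp_neg_mul_rpow (haj j) hq
  have hKv : ∀ j : ℕ, ∀ q : ℝ, 0 < q → ∫ s in Ioi 0, K j q s = Real.Gamma (j + a) / q ^ (a + j) := by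
    intro j q hq
    simp only [hK]
    rw [Real.integral_rpow_mul_exp_neg_mul_Ioi (haj j) hq, Real.div_rpow zero_le_one hq.le,
      Real.one_rpow, add_comm a]
    ring
  have hKp : ∀ j : ℕ, ∀ q s : ℝ, 0 < s →
      K j q s = s ^ (a - 1) * s ^ j * Real.exp (-(q * s)) := by
    intro j q s h0
    simp only [hK]
    rw [← Real.rpow_natCast, ← Real.rpow_add h0]
    congr 2; ring
  have hIoo : Ioo 0 s₀ ⊆ Ioi (0 : ℝ) := Ioo_subset_Ioi_self
  set r : ℝ → ℝ := fun s => h s - ∑ j ∈ Finset.range n, c j * s ^ j with hr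
  have hrm : AEStronglyMeasurable r (volume.restrict (Ioo 0 s₀)) :=
    hm.sub (Measurable.aestronglyMeasurable (by fun_prop))
  have hbd : ∀ q s : ℝ, s ∈ Ioo 0 s₀ →
      |s ^ (a - 1) * r s * Real.exp (-(q * s))| ≤ C * K n q s := by
    intro q s hs'
    rw [hKp n q s hs'.1, abs_mul, abs_mul, abs_of_nonneg (Real.rpow_nonneg hs'.1.le _),
      abs_of_nonneg (Real.exp_nonneg _)]
    calc _ ≤ s ^ (a - 1) * (C * s ^ n) * Real.exp (-(q * s)) := by
          gcongr
          · exact Real.rpow_nonneg hs'.1.le _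
          · exact hC s hs'
      _ = _ := by ring
  have hri : ∀ q : ℝ, 0 < q →
      IntegrableOn (fun s => s ^ (a - 1) * r s * Real.exp (-(q * s))) (Ioo 0 s₀) := by
    intro q hq
    refine (((hKi n q hq).mono_set hIoo).const_mul C).mono' ?_ ?_
    · have h1 : Measurable fun s : ℝ => s ^ (a - 1) := by fun_prop
      have h2 : Measurable fun s : ℝ => Real.exp (-(q * s)) := by fun_prop
      exact (h1.aestronglyMeasurable.mul hrm).mul h2.aestronglyMeasurable
    · filter_upwards [ae_restrict_mem measurableSet_Ioo] with s h using hbd q s h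
  -- Each polynomial term integrates over the whole half-line to an exact Gamma value. What is left
  -- is the Taylor remainder on (0, s₀) and the tails beyond s₀.
  have hmain : ∀ q : ℝ, 0 < q →
      q ^ a * (∫ s in Ioo 0 s₀, s ^ (a - 1) * h s * Real.exp (-(q * s)))
      - ∑ j ∈ Finset.range n, Real.Gamma (j + a) * c j / q ^ j =
      q ^ a * (∫ s in Ioo 0 s₀, s ^ (a - 1) * r s * Real.exp (-(q * s)))
      - ∑ j ∈ Finset.range n, c j * (q ^ a * ∫ s in Ioi s₀, K j q s) := by
    intro q hq
    have e1 : ∫ s in Ioo 0 s₀, s ^ (a - 1) * h s * Real.exp (-(q * s)) =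
        (∫ s in Ioo 0 s₀, s ^ (a - 1) * r s * Real.exp (-(q * s))) +
        ∑ j ∈ Finset.range n, c j * ∫ s in Ioo 0 s₀, K j q s := by
      have hji : ∀ j ∈ Finset.range n, IntegrableOn (fun s => c j * K j q s) (Ioo 0 s₀) :=
        fun j _ => ((hKi j q hq).mono_set hIoo).const_mul _
      simp_rw [← integral_const_mul]
      rw [← integral_finsetSum _ hji, ← integral_add (hri q hq) (integrable_finsetSum _ hji)]
      refine setIntegral_congr_fun measurableSet_Ioo fun s hs' => ?_
      have h2 : ∑ j ∈ Finset.range n, c j * K j q s =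
          s ^ (a - 1) * (∑ j ∈ Finset.range n, c j * s ^ j) * Real.exp (-(q * s)) := by
        rw [Finset.mul_sum, Finset.sum_mul]
        exact Finset.sum_congr rfl fun j _ => by rw [hKp j q s hs'.1]; ring
      simp only [hr, h2]
      ring
    have e2 : ∀ j : ℕ, ∫ s in Ioo 0 s₀, K j q s =
        Real.Gamma (j + a) / q ^ (a + j) - ∫ s in Ioi s₀, K j q s := by
      intro j
      rw [← hKv j q hq, ← Ioc_union_Ioi_eq_Ioi hs.le, setIntegral_union
        (Ioc_disjoint_Ioi le_rfl) measurableSet_Ioi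
        ((hKi j q hq).mono_set Ioc_subset_Ioi_self)
        ((hKi j q hq).mono_set (Ioi_subset_Ioi hs.le)), integral_Ioc_eq_integral_Ioo]
      ring
    rw [e1, mul_add, Finset.mul_sum, add_sub_assoc, ← Finset.sum_sub_distrib,
      sub_eq_add_neg (q ^ a * _), ← Finset.sum_neg_distrib]
    congr 1
    refine Finset.sum_congr rfl fun j _ => ?_
    rw [e2 j, Real.rpow_add hq, Real.rpow_natCast]
    have : q ^ a ≠ 0 := (Real.rpow_pos_of_pos hq a).ne'
    field_simp
    ring
  have hB1 : (fun q : ℝ => q ^ a * (∫ s in Ioo 0 s₀, s ^ (a - 1) * r s * Real.exp (-(q * s))))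
      =O[atTop] fun q : ℝ => 1 / q ^ n := by
    -- The remainder is bounded by the n-th moment, of size q^(-a - n). The sign of C is not
    -- assumed, hence |C|.
    refine IsBigO.of_bound (|C| * Real.Gamma (n + a)) ?_
    filter_upwards [eventually_gt_atTop 0] with q hq
    have h1 : ‖∫ s in Ioo 0 s₀, s ^ (a - 1) * r s * Real.exp (-(q * s))‖ ≤
        |C| * (Real.Gamma (n + a) / q ^ (a + n)) := by
      calc _ ≤ ∫ s in Ioo 0 s₀, |C| * K n q s := by
            refine norm_integral_le_of_norm_le (((hKi n q hq).mono_set hIoo).const_mul _) ?_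
            filter_upwards [ae_restrict_mem measurableSet_Ioo] with s h
            refine (hbd q s h).trans (mul_le_mul_of_nonneg_right (le_abs_self C) ?_)
            exact mul_nonneg (Real.rpow_nonneg h.1.le _) (Real.exp_nonneg _)
        _ = |C| * ∫ s in Ioo 0 s₀, K n q s := integral_const_mul _ _
        _ ≤ |C| * ∫ s in Ioi 0, K n q s := by
            refine mul_le_mul_of_nonneg_left ?_ (abs_nonneg C)
            refine setIntegral_mono_set (hKi n q hq) ?_ hIoo.eventuallyLE
            filter_upwards [ae_restrict_mem measurableSet_Ioi] with s h
            exact mul_nonneg (Real.rpow_nonneg (le_of_lt h) _) (Real.exp_nonneg _)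
        _ = _ := by rw [hKv n q hq]
    have hqa := Real.rpow_pos_of_pos hq a
    rw [norm_mul, Real.norm_of_nonneg hqa.le]
    refine (mul_le_mul_of_nonneg_left h1 hqa.le).trans (le_of_eq ?_)
    rw [Real.rpow_add hq, Real.rpow_natCast, Real.norm_of_nonneg (by positivity)]
    field_simp
  have hB2 : ∀ j ∈ Finset.range n, (fun q : ℝ => c j * (q ^ a * ∫ s in Ioi s₀, K j q s))
      =O[atTop] fun q : ℝ => 1 / q ^ n := fun j _ =>
    (((isBigO_refl (fun q : ℝ => q ^ a) atTop).mul
      (isBigO_setIntegral_Ioi_rpow_mul_exp_neg (haj j) hs)).trans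
      (isBigO_rpow_mul_exp_neg hs n)).const_mul_left (c j)
  refine (hB1.sub (IsBigO.fun_sum hB2)).congr' ?_ .rfl
  filter_upwards [eventually_gt_atTop 0] with q hq using (hmain q hq).symm

end Watson

/-! ### Reduction of the Ball integral to Watson's lemma. -/

section Main

variable {p : ℝ}

/-- Up to π_p/2 this is the monotonicity of sin_p x / x. Beyond, the ratio is at most 1/(π_p/2), its
value at the quarter period, which the same monotonicity bounds by y / F_p(y). -/
lemma abs_pSin_div_le_of_le (hp : 1 < p) {y x : ℝ} (hy : y ∈ Ioc (0 : ℝ) 1)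
    (hyx : pArcsin p y ≤ x) : |pSin p x / x| ≤ y / pArcsin p y := by
  have hF : 0 < pArcsin p y := by
    have := sub_le_pArcsin_sub hp le_rfl hy.1.le hy.2
    rw [pArcsin_zero] at this
    linarith [hy.1]
  have hx : 0 < x := hF.trans_le hyx
  rw [abs_div, abs_of_pos hx, div_le_div_iff₀ hx hF]
  rcases le_or_gt x (pPi p / 2) with h | h
  · have hx' : x ∈ Icc 0 (pPi p / 2) := ⟨hx.le, h⟩
    rw [abs_of_nonneg]
    · exact pSin_mul_le hp hy hyx h
    · rw [pSin_of_mem hp hx']; exact (pSinQuarter_mem hp hx').1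
  · have h1 := pArcsin_mul_le hp hy.1 hy.2 le_rfl
    rw [pArcsin_one] at h1
    have h2 := mul_le_mul_of_nonneg_right (abs_pSin_le_one hp x) hF.le
    nlinarith [hy.1]

/-- Two of the q factors are kept to make the integral converge; the remaining q - 2 supply the
exponential decay. -/
lemma isBigO_setIntegral_Ici_pSin (hp : 1 < p) {x₀ s₀ : ℝ} (hx₀ : 0 < x₀)
    (h : ∀ x, x₀ ≤ x → |pSin p x / x| ≤ Real.exp (-s₀)) :
    (fun q : ℝ => ∫ x in Ici x₀, |pSin p x / x| ^ q) =O[atTop]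
      fun q : ℝ => Real.exp (-(q * s₀)) := by
  set J := ∫ x in Ici x₀, |pSin p x / x| ^ (2 : ℝ) with hJ
  have hi : ∀ q : ℝ, 1 < q → IntegrableOn (fun x => |pSin p x / x| ^ q) (Ici x₀) := fun q hq =>
    (integrableOn_abs_pSin_div_rpow hp hq).mono_set fun x hx => hx₀.trans_le hx
  refine IsBigO.of_bound (J * Real.exp (2 * s₀)) ?_
  filter_upwards [eventually_gt_atTop 2] with q hq
  rw [Real.norm_of_nonneg (setIntegral_nonneg measurableSet_Ici fun x _ => by positivity),
    Real.norm_of_nonneg (Real.exp_nonneg _)]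
  calc ∫ x in Ici x₀, |pSin p x / x| ^ q
      ≤ ∫ x in Ici x₀, |pSin p x / x| ^ (2 : ℝ) * Real.exp (-((q - 2) * s₀)) := by
        refine setIntegral_mono_on (hi q (by linarith)) ((hi 2 (by norm_num)).mul_const _)
          measurableSet_Ici fun x hx => ?_
        have h1 : |pSin p x / x| ^ q = |pSin p x / x| ^ (2 : ℝ) * |pSin p x / x| ^ (q - 2) := by
          rw [← Real.rpow_add_of_nonneg (abs_nonneg _) (by norm_num) (by linarith)]
          congr 1; ring
        rw [h1]
        refine mul_le_mul_of_nonneg_left ?_ (by positivity)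
        calc |pSin p x / x| ^ (q - 2) ≤ Real.exp (-s₀) ^ (q - 2) :=
              Real.rpow_le_rpow (abs_nonneg _) (h x hx) (by linarith)
          _ = Real.exp (-((q - 2) * s₀)) := by rw [← Real.exp_mul]; congr 1; ring
    _ = J * Real.exp (-((q - 2) * s₀)) := integral_mul_const _ _
    _ = J * Real.exp (2 * s₀) * Real.exp (-(q * s₀)) := by
        rw [mul_assoc, ← Real.exp_add]; congr 2; ring

/-- The change of variables `s = log (x / sin_p x)` in the Ball integral near the origin. -/
lemma setIntegral_pSin_eq (hp : 1 < p) {k k' : ℝ → ℝ} {s₀ : ℝ} (hs₀ : 0 < s₀)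
    (hkc : ContinuousOn k (Icc 0 s₀)) (hk : ∀ s ∈ Ioo 0 s₀, HasDerivAt k (k' s) s)
    (hpos : ∀ s ∈ Ioo 0 s₀, 0 < 1 / p * k s + s * k' s)
    (hy : ∀ s ∈ Ioc 0 s₀, ∃ y ∈ Ioo (0 : ℝ) 1, pArcsin p y = s ^ (1 / p) * k s ∧
      s ^ (1 / p) * k s = y * Real.exp s) (q : ℝ) :
    ∫ x in Ioo 0 (s₀ ^ (1 / p) * k s₀), |pSin p x / x| ^ q =
      ∫ s in Ioo 0 s₀, s ^ (1 / p - 1) * (1 / p * k s + s * k' s) * Real.exp (-(q * s)) := by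
  have hp0 : 0 < 1 / p := by positivity
  set X : ℝ → ℝ := fun s => s ^ (1 / p) * k s with hX
  have hXd : ∀ s ∈ Ioo 0 s₀,
      HasDerivAt X (s ^ (1 / p - 1) * (1 / p * k s + s * k' s)) s := by
    intro s hs
    have h1 := (Real.hasDerivAt_rpow_const (x := s) (p := 1 / p) (Or.inl hs.1.ne')).fun_mul
      (hk s hs)
    refine h1.congr_deriv ?_
    have : s ^ (1 / p) = s ^ (1 / p - 1) * s := by
      rw [Real.rpow_sub_one hs.1.ne', div_mul_cancel₀ _ hs.1.ne']
    rw [this]; ring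
  have hXpos : ∀ s ∈ Ioo 0 s₀, 0 < s ^ (1 / p - 1) * (1 / p * k s + s * k' s) := fun s hs =>
    mul_pos (Real.rpow_pos_of_pos hs.1 _) (hpos s hs)
  have hXc : ContinuousOn X (Icc 0 s₀) :=
    (continuousOn_id.rpow_const fun _ _ => Or.inr hp0.le).mul hkc
  have hXm : StrictMonoOn X (Icc 0 s₀) := by
    refine strictMonoOn_of_deriv_pos (convex_Icc 0 s₀) hXc fun s hs => ?_
    rw [interior_Icc] at hs
    rw [(hXd s hs).deriv]
    exact hXpos s hs
  have hX0 : X 0 = 0 := by simp only [hX, Real.zero_rpow hp0.ne', zero_mul]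
  have himg : X '' Ioo 0 s₀ = Ioo 0 (X s₀) := by
    apply Subset.antisymm
    · rintro _ ⟨s, hs, rfl⟩
      rw [← hX0]
      exact ⟨hXm ⟨le_rfl, hs₀.le⟩ (Ioo_subset_Icc_self hs) hs.1,
        hXm (Ioo_subset_Icc_self hs) ⟨hs₀.le, le_rfl⟩ hs.2⟩
    · have := intermediate_value_Ioo hs₀.le hXc
      rwa [hX0] at this
  change ∫ x in Ioo 0 (X s₀), |pSin p x / x| ^ q = _
  rw [← himg, integral_image_eq_integral_abs_deriv_smul measurableSet_Ioo
    (fun s hs => (hXd s hs).hasDerivWithinAt) (hXm.injOn.mono Ioo_subset_Icc_self)]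
  refine setIntegral_congr_fun measurableSet_Ioo fun s hs => ?_
  rw [abs_of_pos (hXpos s hs), smul_eq_mul]
  congr 1
  obtain ⟨y, hy1, hy2, hy3⟩ := hy s (Ioo_subset_Ioc_self hs)
  have hy1' := Ioo_subset_Icc_self hy1
  -- X s is F_p(y), so sin_p inverts it exactly, and X s = y exp s turns the ratio into exp(-s).
  have h1 : pSin p (X s) = y := by
    have : X s = pArcsin p y := hy2.symm
    rw [this, pSin_of_mem hp (pArcsin_mem hp hy1'), pSinQuarter_pArcsin hp hy1']
  have h2 : X s = y * Real.exp s := hy3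
  rw [h1, h2, div_mul_eq_div_div, div_self hy1.1.ne', one_div, ← Real.exp_neg,
    abs_of_pos (Real.exp_pos _), ← Real.exp_mul]
  congr 1; ring

lemma exists_pBall_expansion (hp : 1 < p) : ∃ c : ℕ → ℝ,
    c 0 = 1 / p * (p * (p + 1)) ^ (1 / p) ∧
    c 1 = (1 / p + 1) * ((p * (p + 1)) ^ (1 / p) *
      ((-p ^ 2 + p + 1) / (2 * (2 * p + 1)))) ∧
    HasAsymptoticExpansion (pBall p) fun j : ℕ => Real.Gamma (j + 1 / p) * c j := by
  have hp0 : 0 < p := by linarith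
  have hp1 : 0 < 1 / p := by positivity
  obtain ⟨k, hk, hk0, hk1, hky⟩ := exists_analyticAt_pArcsin_param hp
  set h : ℝ → ℝ := fun s => 1 / p * k s + s * deriv k s with hh
  have hhan : AnalyticAt ℝ h 0 :=
    (analyticAt_const.mul hk).add (analyticAt_id.mul hk.deriv)
  have hh0 : h 0 = 1 / p * k 0 := by simp [hh]
  have hh1 : deriv h 0 = (1 / p + 1) * deriv k 0 := by
    have h1 := (hk.differentiableAt.hasDerivAt.const_mul (1 / p)).fun_add
      ((hasDerivAt_id' (0 : ℝ)).fun_mul hk.deriv.differentiableAt.hasDerivAt)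
    rw [h1.deriv]; ring
  obtain ⟨P, R, hP⟩ := hhan
  obtain ⟨r', hr'0, hr'R⟩ := ENNReal.lt_iff_exists_nnreal_btwn.1 hP.r_pos
  have hr' : 0 < (r' : ℝ) := by exact_mod_cast hr'0
  -- This Taylor estimate has one constant for all |s| < r', giving the remainder bound C (a/r')^n
  -- s^n that `watson` requires.
  obtain ⟨a, ha, C, hC, hbd⟩ := hP.uniform_geometric_approx' hr'R
  refine ⟨P.coeff, ?_, ?_, fun n => ?_⟩
  · rw [← hk0, ← hh0]; exact hP.hasFPowerSeriesAt.coeff_zero 1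
  · rw [← hk0, ← hk1, ← hh1]; exact hP.hasFPowerSeriesAt.deriv.symm
  have hhpos : 0 < h 0 := by rw [hh0, hk0]; positivity
  have hhc : ContinuousAt h 0 := hP.analyticAt.continuousAt
  have hev : ∀ᶠ s in 𝓝 0, AnalyticAt ℝ k s ∧ AnalyticAt ℝ h s ∧ 0 < h s ∧ s < r' :=
    hk.eventually_analyticAt.and (hP.analyticAt.eventually_analyticAt.and
      ((hhc.eventually_const_lt hhpos).and (eventually_lt_nhds hr')))
  -- The interval includes s₁ because the parametrisation at that endpoint supplies the cut-off x₁,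
  -- beyond which the ratio is at most exp(-s₁).
  obtain ⟨s₁, hs₁, H⟩ := mem_nhdsGT_iff_exists_Ioc_subset.1
    ((hev.filter_mono nhdsWithin_le_nhds).and hky)
  rw [mem_Ioi] at hs₁
  have hsol := fun s (hs : s ∈ Ioc 0 s₁) => (H hs).1
  have hkc : ContinuousOn k (Icc 0 s₁) := by
    intro s hs
    rcases hs.1.eq_or_lt with rfl | h0
    · exact hk.continuousAt.continuousWithinAt
    · exact (hsol s ⟨h0, hs.2⟩).1.continuousAt.continuousWithinAt
  have hint := setIntegral_pSin_eq hp hs₁ hkc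
    (fun s hs => (hsol s (Ioo_subset_Ioc_self hs)).1.differentiableAt.hasDerivAt)
    (fun s hs => (hsol s (Ioo_subset_Ioc_self hs)).2.2.1) (fun s hs => (H hs).2)
  obtain ⟨y₁, hy₁, hF₁, hX₁⟩ := (H (right_mem_Ioc.2 hs₁)).2
  set x₁ := s₁ ^ (1 / p) * k s₁ with hx₁
  have hx₁pos : 0 < x₁ := by rw [hX₁]; exact mul_pos hy₁.1 (Real.exp_pos _)
  have htail := isBigO_setIntegral_Ici_pSin hp (s₀ := s₁) hx₁pos fun x hx => by
    have := abs_pSin_div_le_of_le hp (Ioo_subset_Ioc_self hy₁) (hF₁.le.trans hx)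
    rwa [hF₁, hX₁, div_mul_eq_div_div, div_self hy₁.1.ne', one_div, ← Real.exp_neg] at this
  have hmeas : AEStronglyMeasurable h (volume.restrict (Ioo 0 s₁)) := by
    refine ContinuousOn.aestronglyMeasurable (fun s hs => ?_) measurableSet_Ioo
    exact (hsol s (Ioo_subset_Ioc_self hs)).2.1.continuousAt.continuousWithinAt
  have hw := watson hp1 hs₁ hmeas P.coeff n (C := C * (a / r') ^ n) fun s hs => by
    have hs' := hsol s (Ioo_subset_Ioc_self hs)
    have h1 := hbd s (by simpa [abs_of_pos hs.1] using hs'.2.2.2) n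
    rw [zero_add, Real.norm_eq_abs, Real.norm_of_nonneg hs.1.le,
      FormalMultilinearSeries.partialSum] at h1
    simp only [FormalMultilinearSeries.apply_eq_pow_smul_coeff, smul_eq_mul] at h1
    calc |h s - ∑ j ∈ Finset.range n, P.coeff j * s ^ j|
        = |h s - ∑ j ∈ Finset.range n, s ^ j * P.coeff j| := by simp only [mul_comm]
      _ ≤ C * (a * (s / r')) ^ n := h1
      _ = C * (a / r') ^ n * s ^ n := by rw [mul_assoc, ← mul_pow]; congr 2; ring
  have ht := ((isBigO_refl (fun q : ℝ => q ^ (1 / p)) atTop).mul htail).trans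
    (isBigO_rpow_mul_exp_neg hs₁ n)
  refine (hw.add ht).congr' ?_ .rfl
  filter_upwards [eventually_gt_atTop 1] with q hq
  have hsplit : ∫ x in Ioi (0 : ℝ), |pSin p x / x| ^ q =
      (∫ x in Ioo 0 x₁, |pSin p x / x| ^ q) + ∫ x in Ici x₁, |pSin p x / x| ^ q := by
    have hi := integrableOn_abs_pSin_div_rpow hp hq
    have hd : Disjoint (Ioo 0 x₁) (Ici x₁) :=
      disjoint_left.2 fun x hx hx' => (not_le.2 hx.2) (mem_Ici.1 hx')
    have hsub : Ici x₁ ⊆ Ioi (0 : ℝ) := fun x hx => hx₁pos.trans_le hx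
    rw [← Ioo_union_Ici_eq_Ioi hx₁pos, setIntegral_union hd
      measurableSet_Ici (hi.mono_set Ioo_subset_Ioi_self) (hi.mono_set hsub)]
  rw [pBall, hsplit, hint q]
  ring

end Main

theorem theorem4p1 (p : ℝ) (hp : 1 < p) :
    (∀ q : ℝ, 1 < q → IntegrableOn (fun x : ℝ => |pSin p x / x| ^ q) (Ioi 0)) ∧
    (∃ γ : ℕ → ℝ, HasAsymptoticExpansion (pBall p)
      (fun j : ℕ => (p * (p + 1)) ^ (1 / p) * pBallCoeff p γ j)) ∧
    Tendsto (pBall p) atTop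
      (𝓝 (1 / p * Real.Gamma (1 / p) * (p * (p + 1)) ^ (1 / p))) := by
  have hp0 : 0 < p := by linarith
  obtain ⟨c, hc0, hc1, hc⟩ := exists_pBall_expansion hp
  refine ⟨fun q hq => integrableOn_abs_pSin_div_rpow hp hq,
    -- The entries of γ at 0 and 1 are never read; there the explicit coefficients are matched,
    -- using Γ(1 + 1/p) = (1/p) Γ(1/p) for j = 1.
    ⟨fun j => c j / (p * (p + 1)) ^ (1 / p), ?_⟩, ?_⟩
  · convert hc using 2 with j
    have hK : (p * (p + 1)) ^ (1 / p) ≠ 0 := by positivity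
    match j with
    | 0 => simp only [pBallCoeff, hc0, Nat.cast_zero, zero_add]; ring
    | 1 =>
      have : 2 * p + 1 ≠ 0 := by positivity
      simp only [pBallCoeff, hc1, Nat.cast_one]
      rw [add_comm (1 : ℝ) (1 / p), Real.Gamma_add_one (by positivity)]
      field_simp
      ring
    | j + 2 => simp only [pBallCoeff]; field_simp
  -- The limit is the expansion truncated after its constant term, with error O(1/q).
  · have h1 := hc 1
    simp only [Finset.range_one, Finset.sum_singleton, Nat.cast_zero, zero_add, pow_zero, div_one,
      pow_one, hc0] at h1
    have h2 : Tendsto (fun q : ℝ => 1 / q) atTop (𝓝 0) := by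
      simpa using tendsto_inv_atTop_zero (𝕜 := ℝ)
    have h3 := (h1.trans_tendsto h2).add_const
      (Real.Gamma (1 / p) * (1 / p * (p * (p + 1)) ^ (1 / p)))
    simp only [sub_add_cancel, zero_add] at h3
    convert h3 using 2
    ring
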